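/- A directive sequence $\boldsymbol\theta=(\theta^{(n)})_{n\ge 0}$ on finite alphabets $(\mathcal A_n)_{n\ge0}$ consists of maps $\theta^{(n)}\colon\mathcal A_{n+1}\to\mathcal A_n^+$ into non-empty finite words, extended to words by concatenation. It is of constant length, with length sequence $(q_n)_{n\ge0}$, if $|\theta^{(n)}(a)|=q_n$ for all $n$ and all $a\in\mathcal A_{n+1}$. For $n\ge0$ let $X^{(n)}_{\boldsymbol\theta}$ be the set of all $x\in\mathcal A_n^{\mathbb Z}$ each of whose finite subwords is a subword of $\theta^{(n)}\circ\cdots\circ\theta^{(N-1)}(a)$ for some $N>n$ and $a\in\mathcal A_N$; with the left shift $\sigma$ and the product topology of the discrete topologies it is a shift, and $X_{\boldsymbol\theta}:=X^{(0)}_{\boldsymbol\theta}$. A constant-length directive sequence $\boldsymbol\theta$ with length sequence $(q_n)$ is called torsion-free if - $q_n>1$ for infinitely many $n$, - for every $n$, $(X^{(n)}_{\boldsymbol\theta},\sigma)$ is minimal (it is non-empty and its only closed $\sigma$-invariant subsets are $\emptyset$ and itself), - $X_{\boldsymbol\theta}$ contains no $\sigma$-periodic point, and - every prime that divides some $q_k$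 divides $q_n$ for infinitely many $n$. **Corollary 4.9.** Let $\boldsymbol\theta$ and $\boldsymbol\tau$ be torsion-free constant-length directive sequences, each defined on a sequence of finite alphabets of bounded cardinality, with length sequences $(q_n)_{n\ge0}$ and $(\tilde q_n)_{n\ge0}$. Suppose that some prime divides $q_n$ for at least one $n$ but divides no $\tilde q_n$. Then $(X_{\boldsymbol\theta},\sigma)$ is not a topological factor of $(X_{\boldsymbol\tau},\sigma)$, that is, there is no continuous surjection $\pi\colon X_{\boldsymbol\tau}\to X_{\boldsymbol\theta}$ with $\pi\circ\sigma=\sigma\circ\pi$. -/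

import Mathlib

open SymbolicDynamics.FullShift

universe u v

/-- A dynamical system `T : X → X` is minimal if `X` is non-empty and has no non-trivial closed
`T`-invariant subset. -/
def IsMinimalSystem {X : Type*} [TopologicalSpace X] (T : X → X) : Prop :=
  Nonempty X ∧ ∀ Y : Set X, IsClosed Y → Set.MapsTo T Y Y → Y = ∅ ∨ Y = Set.univ

/-- A dynamical system is aperiodic if no point satisfies `T^k x = x` for some `k ≥ 1`. -/
def IsAperiodicSystem {X : Type*} (T : X → X) : Prop :=
  Function.periodicPts T = ∅

/-- `(Y, S)` is a topological factor of `(X, T)`: there is a continuous surjection `π : X → Y`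
with `π ∘ T = S ∘ π`. -/
def IsTopologicalFactor {X Y : Type*} [TopologicalSpace X] [TopologicalSpace Y]
    (S : Y → Y) (T : X → X) : Prop :=
  ∃ π : X → Y, Continuous π ∧ Function.Surjective π ∧ Function.Semiconj π T S

/-- The word `x_{[k, k + m)} = x_k x_{k+1} ⋯ x_{k+m-1}` of a two-sided sequence. -/
def subword {α : Type*} (x : ℤ → α) (k : ℤ) (m : ℕ) : List α :=
  List.ofFn fun i : Fin m => x (k + (i : ℕ))

/-- The left shift `σ`, restricted to a two-sided shift space. -/
def shiftMap {α : Type*} [TopologicalSpace α] (X : Subshift α ℤ) :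
    X.carrier → X.carrier :=
  (X.mapsTo 1).restrict (shift (1 : ℤ)) X.carrier X.carrier

/-- A directive sequence on the alphabets `A n`: morphisms `θ⁽ⁿ⁾ : A (n + 1) → (A n)⁺`, each given
by the non-empty words that are the images of the letters. -/
structure DirectiveSequence (A : ℕ → Type u) where
  /-- The image of a letter under the `n`-th morphism. -/
  image : ∀ n, A (n + 1) → List (A n)
  image_ne_nil : ∀ n a, image n a ≠ []

namespace DirectiveSequence

variable {A : ℕ → Type u}

/-- `θ.supertile n k a` is the word `θ^{[n, n+k)}(a)` over `A n`, for a letter `a` of `A (n + k)`,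
where `θ^{[n, n+k)} = θ⁽ⁿ⁾ ∘ ⋯ ∘ θ⁽ⁿ⁺ᵏ⁻¹⁾` (the identity when `k = 0`). -/
def supertile (θ : DirectiveSequence A) (n : ℕ) : ∀ k : ℕ, A (n + k) → List (A n)
  | 0, a => [a]
  | k + 1, a => (θ.image (n + k) a).flatMap (θ.supertile n k)

/-- The set of all subwords of the words `θ^{[n, N)}(a)`, where `N > n` and `a ∈ A N`. -/
def language (θ : DirectiveSequence A) (n : ℕ) : Set (List (A n)) :=
  {w | ∃ (k : ℕ) (a : A (n + k)), 0 < k ∧ w <:+: θ.supertile n k a}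

/-- The shift `X⁽ⁿ⁾`: the two-sided sequences over `A n` all of whose subwords belong to
`θ.language n`. -/
def levelShift [∀ n, TopologicalSpace (A n)] [∀ n, DiscreteTopology (A n)]
    (θ : DirectiveSequence A) (n : ℕ) : Subshift (A n) ℤ where
  carrier := {x | ∀ (k : ℤ) (m : ℕ), subword x k m ∈ θ.language n}
  isClosed := by
    simp only [Set.ofPred_forall]
    refine isClosed_iInter fun k => isClosed_iInter fun m => ?_
    have h : Continuous fun (x : ℤ → A n) (i : Fin m) => x (k + (i : ℕ)) := by fun_prop
    exact (isClosed_discrete {f : Fin m → A n | List.ofFn f ∈ θ.language n}).preimage h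
  mapsTo := by
    intro g x hx k m
    have h : subword (shift g x) k m = subword x (g + k) m := by
      simp [subword, shift_apply, add_assoc]
    rw [h]
    exact hx (g + k) m

/-- `θ` is a constant-length directive sequence with length sequence `q`: every word `θ⁽ⁿ⁾(a)` has
length `q n`. -/
def HasLengthSequence (θ : DirectiveSequence A) (q : ℕ → ℕ) : Prop :=
  ∀ n a, (θ.image n a).length = q n

/-- `θ` is a torsion-free constant-length directive sequence with length sequence `q`. -/
structure IsTorsionFree [∀ n, TopologicalSpace (A n)] [∀ n, DiscreteTopology (A n)]
    (θ : DirectiveSequence A) (q : ℕ → ℕ) : Prop where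
  hasLengthSequence : θ.HasLengthSequence q
  one_lt_infinitely_often : {n | 1 < q n}.Infinite
  minimal : ∀ n, IsMinimalSystem (shiftMap (θ.levelShift n))
  aperiodic : IsAperiodicSystem (shiftMap (θ.levelShift 0))
  prime_infinitely_often : ∀ p k : ℕ, p.Prime → p ∣ q k → {n | p ∣ q n}.Infinite

end DirectiveSequence

/-- The cardinalities of the alphabets are bounded. -/
def BoundedAlphabets (A : ℕ → Type u) : Prop :=
  ∃ K : ℕ, ∀ n, Nat.card (A n) ≤ K

/-! ### Word complexity. -/

section Words

variable {α : Type*}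

/-! Suppose `π` exists, and let `p` be a prime dividing some `q n` but no `q' n`. Cutting points of
the `θ`-shift into level-`n` supertiles of length `Q` gives a closed set `Y` invariant under `σ^Q`.
Its visit times form a periodic set of period `d ∣ Q`. By minimality they depend locally constantly
on the point (`isLocallyConstant_visitTimes`). Aperiodicity and Morse–Hedlund give `Q ≤ d * (K + 1)`
(`le_minimalPeriod_visitTimes_mul`), so `d` retains nearly all of a large power of `p` dividing `Q`.
Pulled back by `π`, the visit times see only a finite window of a point of the `τ`-shift. Once a
`τ`-supertile of length `Q'` contains that window, at most `K'` letters determine the values along a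
`σ^{Q'}`-orbit, so `d / gcd(d, Q') ≤ K'` (`exists_minimalPeriod_iterate_le`). As `p ∤ Q'`, this
bounds the power of `p` in `d`, a contradiction. -/

theorem subword_eq_subword_iff {x y : ℤ → α} {k l : ℤ} {m : ℕ} :
    subword x k m = subword y l m ↔ ∀ i : ℕ, i < m → x (k + i) = y (l + i) := by
  simp only [subword, List.ofFn_inj, funext_iff]
  exact ⟨fun h i hi => h ⟨i, hi⟩, fun h i => h i i.2⟩

@[simp]
theorem length_subword (x : ℤ → α) (k : ℤ) (m : ℕ) : (subword x k m).length = m := by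
  simp [subword]

theorem take_drop_subword (x : ℤ → α) (k : ℤ) {i j m : ℕ} (h : i + j ≤ m) :
    ((subword x k m).drop i).take j = subword x (k + i) j := by
  refine List.ext_getElem (by simp; omega) fun n h₁ h₂ => ?_
  simp [subword, add_assoc]

theorem finite_range_subword [Finite α] (x : ℤ → α) (m : ℕ) :
    (Set.range fun k => subword x k m).Finite := by
  refine (Set.finite_range fun w : Fin m → α => List.ofFn w).subset ?_
  rintro _ ⟨k, rfl⟩
  exact ⟨_, rfl⟩

/-- The **Morse–Hedlund theorem** for two-sided sequences. -/
theorem add_one_le_ncard_range_subword [Finite α] (x : ℤ → α)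
    (hx : ∀ t : ℕ, 0 < t → ∃ k, x (k + t) ≠ x k) (m : ℕ) :
    m + 1 ≤ (Set.range fun k => subword x k m).ncard := by
  induction m with
  | zero =>
    have := (Set.ncard_pos (finite_range_subword x 0)).2 (Set.range_nonempty _)
    omega
  | succ m ih =>
    suffices h : (Set.range fun k => subword x k m).ncard <
        (Set.range fun k => subword x k (m + 1)).ncard by omega
    by_contra! h
    have hfin := finite_range_subword x (m + 1)
    -- Without growth, deleting the last letter (`i = 0`) or the first (`i = 1`) is injective on
    -- words of length `m + 1`, so every such word extends uniquely both ways.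
    have key : ∀ i : ℕ, i ≤ 1 → ∀ k l : ℤ, subword x (k + i) m = subword x (l + i) m →
        subword x k (m + 1) = subword x l (m + 1) := by
      intro i hi k l hkl
      have himg : (fun w : List α => (w.drop i).take m) ''
          (Set.range fun k => subword x k (m + 1)) = Set.range fun k => subword x k m := by
        ext w
        constructor
        · rintro ⟨_, ⟨k, rfl⟩, rfl⟩
          exact ⟨k + i, (take_drop_subword x k (by omega)).symm⟩
        · rintro ⟨k, rfl⟩
          refine ⟨_, ⟨k - i, rfl⟩, ?_⟩
          simp only
          rw [take_drop_subword x _ (by omega), sub_add_cancel]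
      have hinj := Set.injOn_of_ncard_image_eq
        (le_antisymm (Set.ncard_image_le hfin) (himg ▸ h)) hfin
      refine hinj ⟨k, rfl⟩ ⟨l, rfl⟩ ?_
      simp only
      rw [take_drop_subword x _ (by omega), take_drop_subword x _ (by omega), hkl]
    have hprefix : ∀ k l : ℤ, subword x k (m + 1) = subword x l (m + 1) →
        subword x k m = subword x l m := fun k l hkl => by
      rw [subword_eq_subword_iff] at hkl ⊢
      exact fun i hi => hkl i (by omega)
    have hsuffix : ∀ k l : ℤ, subword x k (m + 1) = subword x l (m + 1) →
        subword x (k + 1) m = subword x (l + 1) m := fun k l hkl => by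
      rw [subword_eq_subword_iff] at hkl ⊢
      intro i hi
      have := hkl (i + 1) (by omega)
      push_cast at this
      rwa [add_assoc, add_assoc, add_comm 1 (i : ℤ)]
    have hper : ∀ k l : ℤ, subword x k (m + 1) = subword x l (m + 1) → ∀ i : ℤ,
        subword x (k + i) (m + 1) = subword x (l + i) (m + 1) := by
      intro k l hkl i
      induction i with
      | zero => simpa using hkl
      | succ i hi =>
        refine key 0 (by omega) _ _ ?_
        have := hsuffix _ _ hi
        simpa [add_assoc] using this
      | pred i hi =>
        refine key 1 le_rfl _ _ ?_
        have := hprefix _ _ hi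
        have e : ∀ k : ℤ, k + (-(i : ℤ) - 1) + (1 : ℕ) = k + -i := fun k => by push_cast; ring
        rwa [e, e]
    obtain ⟨k, -, l, -, hne, hkl⟩ := Set.infinite_univ.exists_ne_map_eq_of_mapsTo
      (f := fun k => subword x k (m + 1)) (fun k _ => Set.mem_range_self k) hfin
    wlog hlt : k < l generalizing k l
    · exact this l k hne.symm hkl.symm (by omega)
    obtain ⟨j, hj⟩ := hx (l - k).toNat (by omega)
    refine hj ?_
    have := (subword_eq_subword_iff.1 (hper k l hkl (j - k))) 0 (by omega)
    simp only [Nat.cast_zero, add_zero] at this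
    rw [show j + ((l - k).toNat : ℤ) = l + (j - k) by omega, ← this]
    congr 1
    omega

end Words

/-! ### Visit times to a closed set invariant under a power. -/

section Visits

variable {X : Type*}

/-- The set of times at which the forward orbit of `x` under `T` visits `Y`. -/
def visitTimes (T : X → X) (Y : Set X) (x : X) : Set ℕ :=
  {i | T^[i] x ∈ Y}

/-- The translation by one of the subsets of `ℕ`. -/
def translateSet (S : Set ℕ) : Set ℕ :=
  {i | i + 1 ∈ S}

theorem translateSet_iterate (S : Set ℕ) (n : ℕ) : translateSet^[n] S = {i | i + n ∈ S} := by
  induction n with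
  | zero => rfl
  | succ n ih =>
    rw [Function.iterate_succ_apply', ih]
    ext i
    simp only [translateSet, Set.mem_ofPred_eq]
    rw [add_right_comm, add_assoc]

theorem visitTimes_iterate (T : X → X) (Y : Set X) (x : X) (n : ℕ) :
    visitTimes T Y (T^[n] x) = translateSet^[n] (visitTimes T Y x) := by
  rw [translateSet_iterate]
  ext i
  simp [visitTimes, Function.iterate_add_apply]

theorem isPeriodicPt_visitTimes {T : X → X} {Y : Set X} {Q : ℕ}
    (hY : ∀ x, T^[Q] x ∈ Y ↔ x ∈ Y) (x : X) :
    Function.IsPeriodicPt translateSet Q (visitTimes T Y x) := by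
  rw [Function.IsPeriodicPt, Function.IsFixedPt, translateSet_iterate]
  ext i
  simp only [visitTimes, Set.mem_ofPred_eq]
  rw [add_comm, Function.iterate_add_apply, hY]

/-- The number of visits per period is upper semicontinuous, since `Y` is closed, and `T`-invariant.
Minimality makes it constant, so the locally valid inclusion of visit sets is an equality. -/
theorem isLocallyConstant_visitTimes [TopologicalSpace X] {T : X → X} (hT : Continuous T)
    (hmin : IsMinimalSystem T) {Y : Set X} (hYc : IsClosed Y) {Q : ℕ} (hQ : 0 < Q)
    (hY : ∀ x, T^[Q] x ∈ Y ↔ x ∈ Y) : IsLocallyConstant (visitTimes T Y) := by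
  classical
  have hper : ∀ x, Function.Periodic (fun i => T^[i] x ∈ Y) Q := fun x i => by
    simp only [eq_iff_iff]
    rw [add_comm, Function.iterate_add_apply, hY]
  let F : X → Finset ℕ := fun x => (Finset.range Q).filter fun i => T^[i] x ∈ Y
  have hFT : ∀ x, (F (T x)).card = (F x).card := by
    intro x
    have h := Nat.filter_Ico_card_eq_of_periodic 1 Q _ (hper x)
    rw [Nat.count_eq_card_filter_range] at h
    rw [← h]
    refine Finset.card_bij (fun i _ => i + 1) ?_ (by simp) ?_
    · intro i hi
      simp only [F, Finset.mem_filter, Finset.mem_range, Finset.mem_Ico] at hi ⊢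
      exact ⟨by omega, hi.2⟩
    · intro i hi
      simp only [F, Finset.mem_filter, Finset.mem_range, Finset.mem_Ico] at hi ⊢
      obtain ⟨j, rfl⟩ : ∃ j, i = j + 1 := ⟨i - 1, by omega⟩
      exact ⟨j, ⟨by omega, hi.2⟩, rfl⟩
  have hopen : ∀ x, IsOpen {y | F y ⊆ F x} := by
    intro x
    have : {y | F y ⊆ F x} = ⋂ i ∈ Finset.range Q \ F x, (T^[i] ⁻¹' Y)ᶜ := by
      ext y
      simp only [F, Finset.subset_iff, Finset.mem_filter, Finset.mem_range, Set.mem_ofPred_eq,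
        Set.mem_iInter, Finset.mem_sdiff, Set.mem_compl_iff, Set.mem_preimage]
      constructor
      · intro h i hi hiY
        exact hi.2 (h ⟨hi.1, hiY⟩)
      · intro h i hi
        by_contra hc
        exact h i ⟨hi.1, hc⟩ hi.2
    rw [this]
    exact isOpen_biInter_finset fun i _ => (hYc.preimage (hT.iterate i)).isOpen_compl
  obtain ⟨hne, hmin⟩ := hmin
  obtain ⟨x₀, hx₀⟩ : ∃ x₀, ∀ x, (F x).card ≤ (F x₀).card := by
    have hfin : (Set.range fun x => (F x).card).Finite :=
      (Set.finite_Iic Q).subset (by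
        rintro _ ⟨x, rfl⟩
        simpa [F] using Finset.card_filter_le (Finset.range Q) fun i => T^[i] x ∈ Y)
    obtain ⟨_, ⟨x₀, rfl⟩, h⟩ := hfin.exists_maximal (Set.range_nonempty _)
    exact ⟨x₀, fun x => (le_total _ _).elim id fun h' => h ⟨x, rfl⟩ h'⟩
  have hconst : ∀ x, (F x).card = (F x₀).card := by
    -- Where the count attains its maximum: a non-empty closed invariant set, hence everything.
    have hclosed : IsClosed {x | (F x₀).card ≤ (F x).card} := by
      rw [← isOpen_compl_iff, isOpen_iff_mem_nhds]
      intro x hx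
      filter_upwards [(hopen x).mem_nhds (Finset.Subset.refl _)] with y hy
      simp only [Set.mem_compl_iff, Set.mem_ofPred_eq, not_le] at hx ⊢
      exact (Finset.card_le_card hy).trans_lt hx
    rcases hmin _ hclosed (fun x hx => by simpa [hFT] using hx) with h | h
    · exact absurd (show x₀ ∈ {x | (F x₀).card ≤ (F x).card} from le_refl (F x₀).card) (h ▸ id)
    · exact fun x => (hx₀ x).antisymm (h ▸ Set.mem_univ x : x ∈ {x | (F x₀).card ≤ (F x).card})
  rw [IsLocallyConstant.iff_exists_open]
  refine fun x => ⟨_, hopen x, Finset.Subset.refl _, fun y hy => ?_⟩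
  have hF : F y = F x :=
    Finset.eq_of_subset_of_card_le hy ((hconst x).trans (hconst y).symm).le
  ext i
  have hred : ∀ z, i ∈ visitTimes T Y z ↔ i % Q ∈ F z := fun z => by
    simp only [F, Finset.mem_filter, Finset.mem_range, Nat.mod_lt _ hQ, true_and]
    exact iff_of_eq ((hper z).map_mod_nat i).symm
  rw [hred, hred, hF]

end Visits

/-! ### Finite windows, concatenated blocks and iterates of the shift. -/

/-- A locally constant function on a shift over a finite alphabet depends on finitely many
coordinates only. -/
theorem exists_window_of_isLocallyConstant {α β : Type*} [Finite α] [TopologicalSpace α]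
    [DiscreteTopology α] {X : Set (ℤ → α)} (hX : IsClosed X) {f : X → β}
    (hf : IsLocallyConstant f) :
    ∃ N : ℕ, ∀ x y : X, (∀ i : ℤ, |i| ≤ N → x.1 i = y.1 i) → f x = f y := by
  have : CompactSpace X := isCompact_iff_compactSpace.1 hX.isCompact
  -- Pairs agreeing on the window of radius `N` but with different values. If none were empty, a
  -- common point would be a pair of equal points with different values.
  let D : ℕ → Set (X × X) := fun N =>
    (⋂ (i : ℤ) (_ : |i| ≤ N), {z : X × X | z.1.1 i = z.2.1 i}) ∩ {z | f z.1 ≠ f z.2}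
  have hlc : IsLocallyConstant fun z : X × X => (f z.1, f z.2) :=
    (hf.comp_continuous continuous_fst).prodMk (hf.comp_continuous continuous_snd)
  have hDc : ∀ N, IsClosed (D N) := fun N =>
    (isClosed_iInter fun i => isClosed_iInter fun _ => isClosed_eq
      ((continuous_apply i).comp (continuous_subtype_val.comp continuous_fst))
      ((continuous_apply i).comp (continuous_subtype_val.comp continuous_snd))).inter
      ⟨hlc {p | p.1 ≠ p.2}ᶜ⟩
  by_contra! h
  have hDanti : ∀ N, D (N + 1) ⊆ D N := by
    intro N z hz
    simp only [D, Set.mem_inter_iff, Set.mem_iInter] at hz ⊢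
    exact ⟨fun i hi => hz.1 i (hi.trans (by push_cast; omega)), hz.2⟩
  have hDne : ∀ N, (D N).Nonempty := by
    intro N
    obtain ⟨x, y, hxy, hne⟩ := h N
    exact ⟨(x, y), Set.mem_iInter₂.2 hxy, hne⟩
  obtain ⟨z, hz⟩ := IsCompact.nonempty_iInter_of_sequence_nonempty_isCompact_isClosed D
    hDanti hDne (hDc 0).isCompact hDc
  rw [Set.mem_iInter] at hz
  refine (hz 0).2 (congrArg f (Subtype.ext (funext fun i => ?_)))
  have := (hz i.natAbs).1
  simp only [Set.mem_iInter, Set.mem_ofPred_eq] at this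
  exact this i (by simp)

theorem List.take_drop_flatten_of_length_eq {α : Type*} {Q : ℕ} {l : List (List α)}
    (hl : ∀ w ∈ l, w.length = Q) {j : ℕ} (hj : j < l.length) :
    (l.flatten.drop (j * Q)).take Q = l[j] := by
  induction l generalizing j with
  | nil => simp at hj
  | cons w l ih =>
    have hw : w.length = Q := hl w (by simp)
    cases j with
    | zero => simp [← hw]
    | succ j =>
      have := ih (fun w' h => hl w' (by simp [h])) (j := j) (by simpa using hj)
      simp only [List.flatten_cons, List.getElem_cons_succ]
      rw [← this, List.drop_append, List.drop_eq_nil_of_le (by rw [hw]; nlinarith),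
        List.nil_append, hw, Nat.succ_mul, Nat.add_sub_cancel]

theorem List.length_flatten_of_length_eq {α : Type*} {Q : ℕ} {l : List (List α)}
    (hl : ∀ w ∈ l, w.length = Q) : l.flatten.length = l.length * Q := by
  rw [List.length_flatten, List.map_congr_left hl]
  simp

theorem List.take_drop_append_append {α : Type*} (s w t : List α) {i j : ℕ}
    (h : i + j ≤ w.length) :
    ((s ++ w ++ t).drop (s.length + i)).take j = (w.drop i).take j := by
  rw [List.append_assoc, ← List.drop_drop, List.drop_left, List.drop_append_of_le_length (by omega),
    List.take_append_of_le_length (by simp; omega)]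

theorem shiftMap_iterate_apply {α : Type*} [TopologicalSpace α] (X : Subshift α ℤ) (n : ℕ)
    (x : X.carrier) (k : ℤ) : ((shiftMap X)^[n] x).1 k = x.1 (k + n) := by
  induction n generalizing k with
  | zero => simp
  | succ n ih =>
    rw [Function.iterate_succ_apply']
    change ((shiftMap X)^[n] x).1 (1 + k) = _
    rw [ih]
    exact congrArg x.1 (by push_cast; ring)

theorem subword_shiftMap_iterate {α : Type*} [TopologicalSpace α] (X : Subshift α ℤ) (n : ℕ)
    (x : X.carrier) (k : ℤ) (m : ℕ) :
    subword ((shiftMap X)^[n] x).1 k m = subword x.1 (k + n) m := by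
  rw [subword_eq_subword_iff]
  intro i _
  rw [shiftMap_iterate_apply, add_right_comm]

theorem continuous_shiftMap {α : Type*} [TopologicalSpace α] (X : Subshift α ℤ) :
    Continuous (shiftMap X) :=
  Continuous.restrict _ (continuous_shift 1)

/-! ### Supertiles and the cyclic structure they induce. -/

namespace DirectiveSequence

variable {A : ℕ → Type u} {θ : DirectiveSequence A} {q : ℕ → ℕ}

theorem length_supertile (h : θ.HasLengthSequence q) (n : ℕ) (a : A (0 + n)) :
    (θ.supertile 0 n a).length = ∏ i ∈ Finset.range n, q i := by
  induction n with
  | zero => simp [supertile]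
  | succ n ih =>
    have himg := h (0 + n) a
    rw [supertile, List.length_flatMap, List.map_congr_left fun b _ => ih b]
    rw [List.map_const', List.sum_replicate, himg, Finset.prod_range_succ, zero_add, smul_eq_mul,
      mul_comm]

theorem exists_supertile_eq_flatten (θ : DirectiveSequence A) {n k : ℕ} (hnk : n ≤ k)
    (a : A (0 + k)) :
    ∃ l : List (List (A 0)), (∀ w ∈ l, w ∈ Set.range (θ.supertile 0 n)) ∧
      θ.supertile 0 k a = l.flatten := by
  induction k, hnk using Nat.le_induction with
  | base => exact ⟨[θ.supertile 0 n a], by simp, by simp⟩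
  | succ k _ ih =>
    choose l hl hlf using ih
    refine ⟨(θ.image (0 + k) a).flatMap l, ?_, ?_⟩
    · intro w hw
      obtain ⟨b, -, hb⟩ := List.mem_flatMap.1 hw
      exact hl b w hb
    · rw [supertile, List.flatMap_def, List.flatMap_def, List.flatten_flatten, List.map_map]
      congr 1
      exact List.map_congr_left fun b _ => hlf b

variable [∀ n, TopologicalSpace (A n)] [∀ n, DiscreteTopology (A n)]

theorem pos_of_isMinimalSystem (h : θ.HasLengthSequence q)
    (hmin : ∀ n, IsMinimalSystem (shiftMap (θ.levelShift n))) (n : ℕ) : 0 < q n := by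
  obtain ⟨x⟩ := (hmin (n + 1)).1
  rw [← h n (x.1 0)]
  exact List.length_pos_iff.2 (θ.image_ne_nil n _)

/-- Every point of the shift can be cut into supertiles of a given level. -/
theorem exists_cut (h : θ.HasLengthSequence q) (hq : ∀ n, 0 < q n) {x : ℤ → A 0}
    (hx : x ∈ (θ.levelShift 0).carrier) (n : ℕ) :
    ∃ c : ℕ, ∀ j : ℤ, subword x (c + j * (∏ i ∈ Finset.range n, q i : ℕ))
      (∏ i ∈ Finset.range n, q i) ∈ Set.range (θ.supertile 0 n) := by
  set Q := ∏ i ∈ Finset.range n, q i with hQdef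
  have hQ : 0 < Q := Finset.prod_pos fun i _ => hq i
  by_contra! hcon
  choose j hj using hcon
  -- The window `[-M, M)` contains a failing block for every residue `c` modulo `Q`.
  set M : ℕ := Q + ∑ c ∈ Finset.range Q, (c + j c * Q).natAbs with hM
  have hbound : ∀ c < Q, (c + j c * Q).natAbs + Q ≤ M := fun c hc => by
    have := Finset.single_le_sum (f := fun c : ℕ => (c + j c * Q).natAbs)
      (fun _ _ => Nat.zero_le _) (Finset.mem_range.2 hc)
    omega
  obtain ⟨k, a, -, s, t, hst⟩ := hx (-M) (2 * M)
  have hlen : s.length + 2 * M + t.length = ∏ i ∈ Finset.range k, q i := by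
    rw [← length_supertile h k a, ← hst]
    simp [add_assoc]
  have hnk : n ≤ k := by
    by_contra! hkn
    have : ∏ i ∈ Finset.range k, q i ≤ Q :=
      Finset.prod_le_prod_of_subset_of_one_le' (Finset.range_mono hkn.le) fun i _ _ => hq i
    omega
  obtain ⟨l, hl, hlf⟩ := θ.exists_supertile_eq_flatten hnk a
  have hlQ : ∀ w ∈ l, w.length = Q := fun w hw => by
    obtain ⟨b, rfl⟩ := hl w hw
    exact length_supertile h n b
  -- The supertile containing the window starts at position `-M - s.length`, which fixes the residue
  -- of its cuts.
  obtain ⟨c, hc⟩ : ∃ c : ℕ, (c : ℤ) = (-M - s.length : ℤ) % Q :=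
    ⟨_, Int.toNat_of_nonneg (Int.emod_nonneg _ (by omega))⟩
  have hcQ : c < Q := by
    have := Int.emod_lt_of_pos (-M - s.length : ℤ) (by exact_mod_cast hQ : (0 : ℤ) < Q)
    omega
  have hb := hbound c hcQ
  obtain ⟨i, hi⟩ : ∃ i : ℕ, (i : ℤ) = c + j c * Q + M := ⟨(c + j c * Q + M).toNat, by omega⟩
  obtain ⟨b, hbQ⟩ : Q ∣ s.length + i := by
    zify
    have h1 : (Q : ℤ) ∣ (-M - s.length : ℤ) - c := hc ▸ Int.dvd_self_sub_emod
    have h2 : (s.length + i : ℤ) = j c * Q - ((-M - s.length : ℤ) - c) := by rw [hi]; ring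
    rw [h2]
    exact dvd_sub (dvd_mul_left _ _) h1
  have hblt : b < l.length := by
    have h1 : l.length * Q = s.length + 2 * M + t.length := by
      rw [hlen, ← length_supertile h k a, hlf, List.length_flatten_of_length_eq hlQ]
    by_contra! hle
    have h2 : l.length * Q ≤ Q * b := by rw [mul_comm]; exact Nat.mul_le_mul_left _ hle
    omega
  refine hj c ?_
  have h1 := List.take_drop_flatten_of_length_eq hlQ hblt
  rw [mul_comm b, ← hbQ, ← hlf, ← hst,
    List.take_drop_append_append _ _ _ (by rw [length_subword]; omega),
    take_drop_subword _ _ (by omega), hi] at h1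
  rw [show (c + j c * Q : ℤ) = -M + (c + j c * Q + M) by ring, h1]
  exact hl _ (List.getElem_mem hblt)

/-- The points of the shift whose blocks starting at the multiples of `Q` are supertiles of
level `n`. -/
def cutAtMultiples (θ : DirectiveSequence A) (n Q : ℕ) : Set (θ.levelShift 0).carrier :=
  {x | ∀ j : ℤ, subword x.1 (j * Q) Q ∈ Set.range (θ.supertile 0 n)}

theorem isClosed_cutAtMultiples (θ : DirectiveSequence A) (n Q : ℕ) :
    IsClosed (θ.cutAtMultiples n Q) := by
  simp only [cutAtMultiples, Set.ofPred_forall]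
  refine isClosed_iInter fun j => ?_
  have h : Continuous fun (x : (θ.levelShift 0).carrier) (i : Fin Q) => x.1 (j * Q + (i : ℕ)) :=
    continuous_pi fun i => (continuous_apply _).comp continuous_subtype_val
  exact (isClosed_discrete
    {f : Fin Q → A 0 | List.ofFn f ∈ Set.range (θ.supertile 0 n)}).preimage h

theorem iterate_mem_cutAtMultiples {n Q c : ℕ} {x : (θ.levelShift 0).carrier} :
    (shiftMap (θ.levelShift 0))^[c] x ∈ θ.cutAtMultiples n Q ↔
      ∀ j : ℤ, subword x.1 (c + j * Q) Q ∈ Set.range (θ.supertile 0 n) := by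
  refine forall_congr' fun j => ?_
  rw [subword_shiftMap_iterate, add_comm (j * Q : ℤ)]

theorem iterate_self_mem_cutAtMultiples {n Q : ℕ} (x : (θ.levelShift 0).carrier) :
    (shiftMap (θ.levelShift 0))^[Q] x ∈ θ.cutAtMultiples n Q ↔ x ∈ θ.cutAtMultiples n Q := by
  rw [iterate_mem_cutAtMultiples]
  constructor
  · intro h j
    have := h (j - 1)
    rwa [show (Q + (j - 1) * Q : ℤ) = j * Q by ring] at this
  · intro h j
    have := h (j + 1)
    rwa [show ((j + 1) * Q : ℤ) = Q + j * Q by ring] at this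

/-- The cyclic partition of an aperiodic constant-length shift induced by the supertiles of
length `Q` has at least `Q / (K + 1)` atoms, where `K` bounds the size of the alphabets. -/
theorem le_minimalPeriod_visitTimes_mul [∀ n, Finite (A n)] (h : θ.HasLengthSequence q)
    (hq : ∀ n, 0 < q n) (hap : IsAperiodicSystem (shiftMap (θ.levelShift 0))) {K : ℕ}
    (hK : ∀ n, Nat.card (A n) ≤ K) {n Q : ℕ} (hQ : ∏ i ∈ Finset.range n, q i = Q)
    (x : (θ.levelShift 0).carrier) :
    Q ≤ Function.minimalPeriod translateSet
      (visitTimes (shiftMap (θ.levelShift 0)) (θ.cutAtMultiples n Q) x) * (K + 1) := by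
  have hQ0 : 0 < Q := hQ ▸ Finset.prod_pos fun i _ => hq i
  set S := visitTimes (shiftMap (θ.levelShift 0)) (θ.cutAtMultiples n Q) x with hS
  set d := Function.minimalPeriod translateSet S with hd
  have hper : Function.IsPeriodicPt translateSet Q S :=
    isPeriodicPt_visitTimes iterate_self_mem_cutAtMultiples x
  have hd0 : 0 < d := hper.minimalPeriod_pos hQ0
  have hdQ : d ≤ Q := hper.minimalPeriod_le hQ0
  have hadd : ∀ i m, i ∈ S → i + d * m ∈ S := by
    intro i m hi
    have : translateSet^[d * m] S = S :=
      (Function.isPeriodicPt_minimalPeriod translateSet S).mul_const m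
    rw [← this, translateSet_iterate] at hi
    exact hi
  obtain ⟨c, hc⟩ : ∃ c, c ∈ S := by
    obtain ⟨c, hc⟩ := exists_cut h hq x.2 n
    rw [hQ] at hc
    exact ⟨c, iterate_mem_cutAtMultiples.2 hc⟩
  -- Supertiles start at all positions `c + d * j`, so every position is at offset `e < d` from one.
  -- A word of length `Q - d + 1` starting there still fits inside.
  have hsub : (Set.range fun k => subword x.1 k (Q - d + 1)) ⊆
      Set.image2 (fun w e => (w.drop e).take (Q - d + 1))
        (Set.range (θ.supertile 0 n)) (Set.Iio d) := by
    rintro _ ⟨k, rfl⟩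
    obtain ⟨e, he⟩ : ∃ e : ℕ, (e : ℤ) = (k - c) % d :=
      ⟨_, Int.toNat_of_nonneg (Int.emod_nonneg _ (by omega))⟩
    have hed : e < d := by
      have := Int.emod_lt_of_pos (k - c) (by exact_mod_cast hd0 : (0 : ℤ) < d)
      omega
    set j := (k - c) / d with hj
    have hk : k = c + d * j + e := by
      have := Int.mul_ediv_add_emod (k - c) d
      rw [he, hj]
      linarith
    obtain ⟨b, hb⟩ : ∃ b : ℕ, b = j.natAbs := ⟨_, rfl⟩
    -- `S` records only non-negative times and `j` may be negative: move right by `d * b` blocks of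
    -- length `Q`, then back.
    obtain ⟨m, hm⟩ : ∃ m : ℕ, (m : ℤ) = j + Q * b := by
      refine ⟨_, Int.toNat_of_nonneg ?_⟩
      have h1 : (1 : ℤ) ≤ Q := by exact_mod_cast hQ0
      have h2 : (b : ℤ) ≤ Q * b := le_mul_of_one_le_left (by positivity) h1
      omega
    have hmem := iterate_mem_cutAtMultiples.1 (hadd c m hc) (-(d * b))
    rw [show ((c + d * m : ℕ) + -(d * b) * Q : ℤ) = c + d * j by
      push_cast; rw [hm]; ring] at hmem
    refine ⟨_, hmem, e, hed, ?_⟩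
    simp only
    rw [take_drop_subword _ _ (by omega), hk]
  have hfin : (Set.image2 (fun w e => (w.drop e).take (Q - d + 1))
      (Set.range (θ.supertile 0 n)) (Set.Iio d)).Finite :=
    (Set.finite_range _).image2 _ (Set.finite_Iio d)
  have hcard : (Set.image2 (fun w e => (w.drop e).take (Q - d + 1))
      (Set.range (θ.supertile 0 n)) (Set.Iio d)).ncard ≤ K * d := by
    rw [← Set.image_uncurry_prod]
    refine (Set.ncard_image_le ((Set.finite_range _).prod (Set.finite_Iio d))).trans ?_
    rw [Set.ncard_prod]
    refine Nat.mul_le_mul ?_ (by simp)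
    rw [← Set.image_univ]
    exact (Set.ncard_image_le Set.finite_univ).trans (by rw [Set.ncard_univ]; exact hK _)
  have hMH := add_one_le_ncard_range_subword x.1 (fun t ht => by
    by_contra! hcon
    have : x ∈ Function.periodicPts (shiftMap (θ.levelShift 0)) :=
      ⟨t, ht, Subtype.ext (funext fun k => by rw [shiftMap_iterate_apply, hcon])⟩
    rw [hap] at this
    exact this) (Q - d + 1)
  -- This reads `Q - d + 2 ≤ K * d`.
  have := (hMH.trans (Set.ncard_le_ncard hsub hfin)).trans hcard
  rw [mul_add, mul_one, mul_comm]
  omega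

end DirectiveSequence

/-! ### Growth and divisibility of partial products. -/

/-- If infinitely many terms of a sequence of positive integers are multiples of `m`, then every
power of `m` divides some partial product. -/
theorem exists_pow_dvd_prod_range {q : ℕ → ℕ} {m : ℕ} (h : {n | m ∣ q n}.Infinite) (v : ℕ) :
    ∃ n, m ^ v ∣ ∏ i ∈ Finset.range n, q i := by
  induction v with
  | zero => exact ⟨0, by simp⟩
  | succ v ih =>
    obtain ⟨n, hn⟩ := ih
    obtain ⟨k, hk, hnk⟩ := h.exists_gt n
    refine ⟨k + 1, ?_⟩
    rw [Finset.prod_range_succ, pow_succ]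
    exact mul_dvd_mul (hn.trans (Finset.prod_dvd_prod_of_subset _ _ _
      (Finset.range_mono hnk.le))) hk

theorem exists_le_prod_range {q : ℕ → ℕ} (hq : ∀ n, 0 < q n) (h : {n | 1 < q n}.Infinite)
    (N : ℕ) : ∃ n, N ≤ ∏ i ∈ Finset.range n, q i := by
  induction N with
  | zero => exact ⟨0, by simp⟩
  | succ N ih =>
    obtain ⟨n, hn⟩ := ih
    obtain ⟨k, hk, hnk⟩ := h.exists_gt n
    refine ⟨k + 1, ?_⟩
    have h1 : ∏ i ∈ Finset.range n, q i ≤ ∏ i ∈ Finset.range k, q i :=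
      Finset.prod_le_prod_of_subset_of_one_le' (Finset.range_mono hnk.le) fun i _ _ => hq i
    have h2 : 0 < ∏ i ∈ Finset.range k, q i := Finset.prod_pos fun i _ => hq i
    rw [Finset.prod_range_succ]
    have h3 : 1 < q k := hk
    nlinarith

/-! ### Periods visible from the other shift. -/

namespace DirectiveSequence

/-- For an equivariant locally constant map from a constant-length shift, the part of the period
of a value that is coprime to the length of the supertiles is bounded by the size of the
alphabets. -/
theorem exists_minimalPeriod_iterate_le {B : ℕ → Type v} [∀ n, Finite (B n)]
    [∀ n, TopologicalSpace (B n)] [∀ n, DiscreteTopology (B n)] {τ : DirectiveSequence B}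
    {q : ℕ → ℕ} (h : τ.HasLengthSequence q) (hq : ∀ n, 0 < q n) (hinf : {n | 1 < q n}.Infinite)
    {K : ℕ} (hK : ∀ n, Nat.card (B n) ≤ K) (y : (τ.levelShift 0).carrier)
    {β : Type*} {R : β → β} {G : (τ.levelShift 0).carrier → β} (hG : IsLocallyConstant G)
    (hGR : Function.Semiconj G (shiftMap (τ.levelShift 0)) R) :
    ∃ (n : ℕ) (z : (τ.levelShift 0).carrier),
      Function.minimalPeriod R^[∏ i ∈ Finset.range n, q i] (G z) ≤ K := by
  obtain ⟨N, hN⟩ := exists_window_of_isLocallyConstant (τ.levelShift 0).isClosed hG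
  obtain ⟨n, hn⟩ := exists_le_prod_range hq hinf (2 * N + 1)
  obtain ⟨c, hc⟩ := exists_cut h hq y.2 n
  set Q := ∏ i ∈ Finset.range n, q i with hQ
  set T := shiftMap (τ.levelShift 0) with hT
  -- The shift by `c + N` puts the window `[-N, N]` of each `T^[j * Q] z` at the start of a
  -- supertile, where its `2 * N + 1` letters fit.
  refine ⟨n, T^[c + N] y, ?_⟩
  set z := T^[c + N] y with hz
  set R' := R^[Q] with hR'
  set P := Function.minimalPeriod R' (G z) with hP
  have hiter : ∀ j, R'^[j] (G z) = G (T^[j * Q] z) := fun j => by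
    rw [hR', ← Function.iterate_mul, mul_comm Q j]
    exact ((hGR.iterate_right (j * Q)) z).symm
  choose a ha using fun j : ℕ => hc j
  have hinj : Set.InjOn a (Set.Iio P) := by
    intro i hi j hj hij
    refine Function.iterate_injOn_Iio_minimalPeriod hi hj ?_
    simp only
    rw [hiter, hiter]
    refine hN _ _ fun m hm => ?_
    rw [abs_le] at hm
    have hsub : subword y.1 (c + (i : ℤ) * Q) Q = subword y.1 (c + (j : ℤ) * Q) Q := by
      rw [← ha i, ← ha j, hij]
    rw [shiftMap_iterate_apply, shiftMap_iterate_apply, hz, shiftMap_iterate_apply,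
      shiftMap_iterate_apply]
    have := subword_eq_subword_iff.1 hsub (m + N).toNat (by omega)
    rw [Int.toNat_of_nonneg (by omega)] at this
    convert this using 2 <;> push_cast <;> ring
  have := Set.ncard_le_ncard (Set.subset_univ (a '' Set.Iio P))
  rw [hinj.ncard_image, Set.ncard_univ] at this
  simpa using this.trans (hK _)

end DirectiveSequence

/-! ### The contradiction. -/

open DirectiveSequence in
theorem corollary4p9
    {A : ℕ → Type u} [∀ n, Finite (A n)]
    [∀ n, TopologicalSpace (A n)] [∀ n, DiscreteTopology (A n)]
    {B : ℕ → Type v} [∀ n, Finite (B n)]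
    [∀ n, TopologicalSpace (B n)] [∀ n, DiscreteTopology (B n)]
    (hA : BoundedAlphabets A) (hB : BoundedAlphabets B)
    (θ : DirectiveSequence A) (τ : DirectiveSequence B)
    (q q' : ℕ → ℕ) (hθ : θ.IsTorsionFree q) (hτ : τ.IsTorsionFree q')
    (hp : ∃ p : ℕ, p.Prime ∧ (∃ n, p ∣ q n) ∧ ∀ n, ¬ p ∣ q' n) :
    ¬ IsTopologicalFactor (shiftMap (θ.levelShift 0)) (shiftMap (τ.levelShift 0)) := by
  rintro ⟨π, hπ, -, hsemi⟩
  obtain ⟨p, hp, ⟨k, hk⟩, hndvd⟩ := hp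
  obtain ⟨K, hK⟩ := hA
  obtain ⟨K', hK'⟩ := hB
  have hq := pos_of_isMinimalSystem hθ.hasLengthSequence hθ.minimal
  have hq' := pos_of_isMinimalSystem hτ.hasLengthSequence hτ.minimal
  -- The final bound on a positive multiple of `p ^ v`, which exceeds `v`.
  set v := K' * (K + 1) with hv
  obtain ⟨n, hn⟩ := exists_pow_dvd_prod_range (hθ.prime_infinitely_often p k hp hk) v
  obtain ⟨Q, hQ⟩ : ∃ Q, ∏ i ∈ Finset.range n, q i = Q := ⟨_, rfl⟩
  have hQ0 : 0 < Q := hQ ▸ Finset.prod_pos fun i _ => hq i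
  rw [hQ] at hn
  set S := visitTimes (shiftMap (θ.levelShift 0)) (θ.cutAtMultiples n Q) with hS
  have hSlc : IsLocallyConstant S :=
    isLocallyConstant_visitTimes (continuous_shiftMap _) (hθ.minimal 0)
      (θ.isClosed_cutAtMultiples n Q) hQ0 iterate_self_mem_cutAtMultiples
  have hSR : Function.Semiconj S (shiftMap (θ.levelShift 0)) translateSet :=
    fun x => visitTimes_iterate _ _ x 1
  obtain ⟨y⟩ := (hτ.minimal 0).1
  obtain ⟨m, z, hz⟩ := exists_minimalPeriod_iterate_le hτ.hasLengthSequence hq'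
    hτ.one_lt_infinitely_often hK' y (hSlc.comp_continuous hπ) (hSR.comp_left hsemi)
  set Q' := ∏ i ∈ Finset.range m, q' i with hQ'
  have hQ'0 : 0 < Q' := Finset.prod_pos fun i _ => hq' i
  rw [Function.minimalPeriod_iterate_eq_div_gcd hQ'0.ne', Function.comp_apply] at hz
  have hle := le_minimalPeriod_visitTimes_mul hθ.hasLengthSequence hq hθ.aperiodic hK hQ (π z)
  have hper : Function.IsPeriodicPt translateSet Q (S (π z)) :=
    isPeriodicPt_visitTimes iterate_self_mem_cutAtMultiples _
  set d := Function.minimalPeriod translateSet (S (π z)) with hd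
  have hd0 : 0 < d := hper.minimalPeriod_pos hQ0
  obtain ⟨r, hr⟩ : d ∣ Q := hper.minimalPeriod_dvd
  have hrK : r ≤ K + 1 := by
    rw [hr] at hle
    exact Nat.le_of_mul_le_mul_left hle hd0
  have hcop : (p ^ v).Coprime (d.gcd Q') := by
    refine Nat.Coprime.pow_left _ ((hp.coprime_iff_not_dvd).2 fun hdvd => ?_)
    obtain ⟨i, -, hi⟩ := (hp.prime.dvd_finsetProd_iff _).1 (hdvd.trans (Nat.gcd_dvd_right _ _))
    exact hndvd i hi
  -- `p ^ v` divides `Q = d * r` and is coprime to the factor `d.gcd Q'`.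
  have hdvd : p ^ v ∣ d / d.gcd Q' * r := by
    refine hcop.dvd_of_dvd_mul_left ?_
    rwa [← mul_assoc, Nat.mul_div_cancel' (Nat.gcd_dvd_left _ _), ← hr]
  have hpos : 0 < d / d.gcd Q' * r :=
    Nat.mul_pos (Nat.div_pos (Nat.gcd_le_left _ hd0) (Nat.gcd_pos_of_pos_left _ hd0))
      (Nat.pos_of_ne_zero fun h0 => by simp [h0] at hr; omega)
  have hlt : v < p ^ v := Nat.lt_pow_self hp.one_lt
  exact absurd ((Nat.le_of_dvd hpos hdvd).trans (Nat.mul_le_mul hz hrK)) (by omega)
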